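/- Let $M$ and $N$ be smooth ($C^\infty$) manifolds without boundary, Hausdorff and second countable, of finite dimensions $m$ and $d$. "Chart" means a chart of the maximal smooth atlas. Let $k\ge 0$ be an integer. For a compact set $K\subset\mathbb R^m$ and an $\mathbb R^d$-valued $C^k$ map $h$ defined on a neighbourhood of $K$, put $$[h]_{C^k,K}=\max_{0<j\le k}\ \sup_{x\in K}|D^jh(x)|,\qquad [h]_{C^{k+\alpha},K}=[h]_{C^k,K}+\sup_{x,y\in K,\ x\ne y}\frac{|D^kh(x)-D^kh(y)|}{|x-y|^{\alpha}}\quad(0<\alpha<1),$$ where $|D^jh|$ is the operator norm and the maximum is $0$ if $k=0$; put $[h]_{C^{k+0},K}=[h]_{C^k,K}$, and let $[h]_{C^{k+\mathrm{Lip}},K}$ be given by the second formula with exponent $1$ in place of $\alpha$. Let $r$ be one of the symbols $k+\alpha$ with $\alpha\in[0,1)$, or $k+\mathrm{Lip}$, and put $\|h\|_{r,K}=\sup_K|h|+[h]_{C^r,K}$. Let $C^r(M,N)$ be the set of $C^k$ maps $f\colon M\to N$ such that $\|\psi\circ f\circ\varphi^{-1}\|_{r,\varphi(K)}<\infty$ for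 all charts $(U,\varphi)$ of $M$ and $(V,\psi)$ of $N$ and all compact $K\subset U$ with $f(K)\subset V$. For such data with $f(K)\subset V$, and $\epsilon\in(0,\infty]$, let $\mathcal N(f;(U,\varphi),(V,\psi),K,\epsilon)$ be the set of $g\in C^r(M,N)$ with $$g(K)\subset V\quad\text{and}\quad \|\psi\circ f\circ\varphi^{-1}-\psi\circ g\circ\varphi^{-1}\|_{r,\varphi(K)}<\epsilon .$$ The weak $C^r$-Whitney topology on $C^r(M,N)$ is the topology generated by all these sets. The strong $C^r$-Whitney topology is the topology generated by all sets $\bigcap_{t\in T}\mathcal N(f;(U_t,\varphi_t),(V_t,\psi_t),K_t,\epsilon_t)$, where $f\in C^r(M,N)$, $((U_t,\varphi_t))_{t\in T}$ is a family of charts of $M$ with $(U_t)_{t\in T}$ locally finite, $(V_t,\psi_t)$ are charts of $N$, $K_t\subset U_t$ is compact with $f(K_t)\subset V_t$, and $\epsilon_t\in(0,\infty]$. **Theorem.** For every integer $k\ge0$ and every $\alpha\in[0,1)$, the weak and the strong $C^{k+\alpha}$-Whitney topologies on $C^{k+\alpha}(M,N)$ are Baire (every countable intersection of open dense sets is dense).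 For every integer $k\ge0$, the weak and the strong $C^{k+\mathrm{Lip}}$-Whitney topologies on $C^{k+\mathrm{Lip}}(M,N)$ are Baire as well. -/

import Mathlib

open Set Topology
open scoped ENNReal Manifold ContDiff

noncomputable section

namespace Whitney

/-- A family of extended-real-valued semi-norms, one for each set `K ⊆ ℝᵐ` (only compact `K` are
used), evaluated on maps defined near `K` with values in `ℝᵈ`.  Maps are total functions; the
semi-norms below depend only on the germ of the map along `K`. -/
abbrev SeminormFamily (m d : ℕ) : Type :=
  Set (EuclideanSpace ℝ (Fin m)) →
    (EuclideanSpace ℝ (Fin m) → EuclideanSpace ℝ (Fin d)) → ℝ≥0∞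

/-- The `C⁰`-norm `sup_{x ∈ K} |f x|`. -/
def supNorm {m d : ℕ} (K : Set (EuclideanSpace ℝ (Fin m)))
    (f : EuclideanSpace ℝ (Fin m) → EuclideanSpace ℝ (Fin d)) : ℝ≥0∞ :=
  ⨆ x ∈ K, ‖f x‖ₑ

/-- The norm `‖f‖_K = ‖f‖_{C⁰(K)} + [f]_K` attached to a family of semi-norms. -/
def SeminormFamily.norm {m d : ℕ} (S : SeminormFamily m d)
    (K : Set (EuclideanSpace ℝ (Fin m)))
    (f : EuclideanSpace ℝ (Fin m) → EuclideanSpace ℝ (Fin d)) : ℝ≥0∞ :=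
  supNorm K f + S K f

/-- The `α`-Hölder semi-norm `sup_{x ≠ y ∈ K} |g x - g y| / d(x, y)^α`
(the Lipschitz semi-norm for `α = 1`). -/
def holderSeminorm {X E : Type*} [MetricSpace X] [NormedAddCommGroup E]
    (α : ℝ) (K : Set X) (g : X → E) : ℝ≥0∞ :=
  ⨆ x ∈ K, ⨆ y ∈ K, ⨆ _ : x ≠ y, ‖g x - g y‖ₑ / edist x y ^ α

/-- The `C^k`-semi-norm `max_{0 < j ≤ k} sup_{x ∈ K} |D^j f x|` (operator norms). -/
def ckSeminorm {m d : ℕ} (k : ℕ) : SeminormFamily m d :=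
  fun K f => ⨆ j ∈ Ioc 0 k, ⨆ x ∈ K, ‖iteratedFDeriv ℝ j f x‖ₑ

open Classical in
/-- The `C^{k+α}`-semi-norm: `[f]_{C^k, K}` if `α = 0`, and
`[f]_{C^k, K} + [D^k f]_{α, K}` if `0 < α < 1`. -/
def ckHolderSeminorm {m d : ℕ} (k : ℕ) (α : ℝ) : SeminormFamily m d :=
  fun K f =>
    if α = 0 then ckSeminorm k K f
    else ckSeminorm k K f + holderSeminorm α K (iteratedFDeriv ℝ k f)

/-- The `C^{k+Lip}`-semi-norm `[f]_{C^k, K} + [D^k f]_{Lip, K}`. -/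
def ckLipSeminorm {m d : ℕ} (k : ℕ) : SeminormFamily m d :=
  fun K f => ckSeminorm k K f + holderSeminorm 1 K (iteratedFDeriv ℝ k f)

section Manifolds

variable {m d : ℕ}
  {M : Type*} [TopologicalSpace M] [ChartedSpace (EuclideanSpace ℝ (Fin m)) M]
  {N : Type*} [TopologicalSpace N] [ChartedSpace (EuclideanSpace ℝ (Fin d)) N]

/-- `φ` and `ψ` are smooth charts of `M` and `N`, and `K` is a compact subset of the domain
of `φ`. -/
structure ChartData (φ : OpenPartialHomeomorph M (EuclideanSpace ℝ (Fin m)))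
    (ψ : OpenPartialHomeomorph N (EuclideanSpace ℝ (Fin d))) (K : Set M) : Prop where
  source_mem : φ ∈ IsManifold.maximalAtlas (𝓡 m) ∞ M
  target_mem : ψ ∈ IsManifold.maximalAtlas (𝓡 d) ∞ N
  isCompact : IsCompact K
  subset_source : K ⊆ φ.source

variable (M N) in
/-- The set `C^𝓕(M, N)` for a family `S` of semi-norms of differentiability order `k`: the
`C^k` maps `f : M → N` whose local representatives `ψ ∘ f ∘ φ⁻¹` have finite norm on `φ(K)`,
for all smooth charts `(U, φ)`, `(V, ψ)` and all compact `K ⊆ U` with `f(K) ⊆ V`.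
For `k = 0`, `C^k` means continuous. -/
def maps (k : ℕ) (S : SeminormFamily m d) : Set (M → N) :=
  {f | ContMDiff (𝓡 m) (𝓡 d) k f ∧
    ∀ (φ : OpenPartialHomeomorph M (EuclideanSpace ℝ (Fin m)))
      (ψ : OpenPartialHomeomorph N (EuclideanSpace ℝ (Fin d))) (K : Set M),
      ChartData φ ψ K → MapsTo f K ψ.source → S.norm (φ '' K) (ψ ∘ f ∘ φ.symm) < ⊤}

/-- The weak sub-basic neighbourhood `𝓝(f; (U, φ), (V, ψ), K, ε)`: the maps `g` with
`g(K) ⊆ V` and `‖ψ ∘ f ∘ φ⁻¹ - ψ ∘ g ∘ φ⁻¹‖_{φ(K)} < ε`. -/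
def nhd {k : ℕ} {S : SeminormFamily m d} (f : maps M N k S)
    (φ : OpenPartialHomeomorph M (EuclideanSpace ℝ (Fin m)))
    (ψ : OpenPartialHomeomorph N (EuclideanSpace ℝ (Fin d))) (K : Set M) (ε : ℝ≥0∞) :
    Set (maps M N k S) :=
  {g | MapsTo g.1 K ψ.source ∧
    S.norm (φ '' K) (ψ ∘ f.1 ∘ φ.symm - ψ ∘ g.1 ∘ φ.symm) < ε}

variable (M N) in
/-- The weak Whitney topology, generated by the weak sub-basic neighbourhoods; `ε` ranges over
the positive extended reals. -/
abbrev weakTopology (k : ℕ) (S : SeminormFamily m d) : TopologicalSpace (maps M N k S) :=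
  TopologicalSpace.generateFrom
    {W | ∃ (f : maps M N k S) (φ : OpenPartialHomeomorph M (EuclideanSpace ℝ (Fin m)))
      (ψ : OpenPartialHomeomorph N (EuclideanSpace ℝ (Fin d))) (K : Set M) (ε : ℝ≥0∞),
      ChartData φ ψ K ∧ MapsTo f.1 K ψ.source ∧ 0 < ε ∧ W = nhd f φ ψ K ε}

variable (M N) in
/-- The strong Whitney topology, generated by the strong basic neighbourhoods
`𝓝ₛ(f; Φ, Ψ, K, ε) = {g | g(K_t) ⊆ V_t, ‖ψ_t ∘ f ∘ φ_t⁻¹ - ψ_t ∘ g ∘ φ_t⁻¹‖_{φ_t(K_t)} < ε_t ∀ t}`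
over families of charts `(U_t, φ_t)` with `(U_t)` locally finite in `M`.  (A locally finite family
of non-empty subsets of a second countable space is countable, so index types in the lowest
universe suffice.) -/
abbrev strongTopology (k : ℕ) (S : SeminormFamily m d) : TopologicalSpace (maps M N k S) :=
  TopologicalSpace.generateFrom
    {W | ∃ (f : maps M N k S) (T : Type)
      (φ : T → OpenPartialHomeomorph M (EuclideanSpace ℝ (Fin m)))
      (ψ : T → OpenPartialHomeomorph N (EuclideanSpace ℝ (Fin d)))
      (K : T → Set M) (ε : T → ℝ≥0∞),
      LocallyFinite (fun t => (φ t).source) ∧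
      (∀ t, ChartData (φ t) (ψ t) (K t) ∧ MapsTo f.1 (K t) (ψ t).source ∧ 0 < ε t) ∧
      W = {g | ∀ t, g ∈ nhd f (φ t) (ψ t) (K t) (ε t)}}

end Manifolds

end Whitney

end

/-!
For `0 ≤ α ≤ 1` the Lipschitz case is the case `α = 1` of the Hölder case (`ckLipSeminorm_eq`), so
only `C^{k+α}(M, N)` has to be considered.

The weak and the strong topology have the same kind of neighbourhood bases: balls
`ChartFamily.ball` around `f`, given by families of charts `φ t`, `ψ t`, compact sets `K t` and
radii `ε t`, where the family is finite for the weak topology and the domains of the `φ t` are locally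
finite for the strong one.  All that the proof uses about these two classes of families is collected
in `Describes`; in particular they contain the finite families and are closed under disjoint unions.

The Baire property follows from a completeness argument (`Describes.baireSpace`).  Given dense open
sets `O n` and a nonempty open set `U`, one chooses maps `f n` and families `D n` centred at `f n`
such that `f (n + 1)` lies in the ball of `D n` and in `O n`, such that `D (n + 1)` contains all
members of `D n` with radii halved, and such that the interiors of the compact sets that occur cover
`M`.  In every chart of `D n` the tail of the sequence then converges geometrically for the
`C^{k+α}` norm.  The pointwise limit `g` exists because the radii are so small that a closed
neighbourhood of the image of `K t` lies in the target of `ψ t` (`ChartFamily.Good`), and it is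
`C^k` with the expected estimates by the theorem on uniform limits of derivatives
(`contDiffOn_and_boundedBy_of_geometric`).  These estimates hold on the interiors of the sets `K t`
only; therefore the compact sets of a given basic neighbourhood are enlarged first
(`ChartFamily.Valid.exists_good`), so that `g` lies in `U` and in every `O n`.

Membership in `C^{k+α}(M, N)` requires finite norms in all charts, whereas the limit is controlled
in the charts of the families `D n`.  This gap is closed by the local notion `HolderAt` of a `C^{k+α}`
map, which is invariant under composition with smooth maps on either side (by induction on `k`, via
the product rule for bounded bilinear maps), and which implies finite norms on compact sets
(`norm_lt_top_of_holderAt`).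
-/

namespace Whitney

open Filter Asymptotics

/-! ### Local Hölder regularity and composition with smooth maps -/

section LocalHolder

universe u

variable {E F G H : Type u} [NormedAddCommGroup E] [NormedSpace ℝ E]
  [NormedAddCommGroup F] [NormedSpace ℝ F] [NormedAddCommGroup G] [NormedSpace ℝ G]
  [NormedAddCommGroup H] [NormedSpace ℝ H] {α : ℝ} {k : ℕ} {x : E}

/-- `f` is of class `C^{k+α}` near `x`: it is `C^k` at `x` and its `k`-th derivative is `α`-Hölder
on a neighbourhood of `x`.  The Hölder condition is expressed as a big-O estimate near the point
`(x, x)` of the diagonal; for `α = 0` it follows from the `C^k` condition. -/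
structure HolderAt (k : ℕ) (α : ℝ) (f : E → F) (x : E) : Prop where
  contDiffAt : ContDiffAt ℝ k f x
  isBigO : (fun p : E × E => iteratedFDeriv ℝ k f p.1 - iteratedFDeriv ℝ k f p.2)
    =O[𝓝 (x, x)] fun p => ‖p.1 - p.2‖ ^ α

theorem isBigO_sub_rpow {E : Type*} [NormedAddCommGroup E] {x : E} (hα₀ : 0 ≤ α) (hα₁ : α ≤ 1) :
    (fun p : E × E => p.1 - p.2) =O[𝓝 (x, x)] fun p => ‖p.1 - p.2‖ ^ α := by
  refine IsBigO.of_bound 1 ?_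
  have hc : ContinuousAt (fun p : E × E => ‖p.1 - p.2‖) (x, x) := by fun_prop
  filter_upwards [hc.eventually_lt (continuousAt_const (y := (1 : ℝ))) (by simp)] with p hp
  rw [Real.norm_of_nonneg (by positivity), one_mul]
  simpa using Real.rpow_le_rpow_of_exponent_ge' (norm_nonneg (p.1 - p.2)) hp.le hα₀ hα₁

theorem _root_.ContDiffAt.isBigO_sub_rpow {f : E → F} (hf : ContDiffAt ℝ 1 f x)
    (hα₀ : 0 ≤ α) (hα₁ : α ≤ 1) :
    (fun p : E × E => f p.1 - f p.2) =O[𝓝 (x, x)] fun p => ‖p.1 - p.2‖ ^ α :=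
  (hf.hasStrictFDerivAt one_ne_zero).isBigO_sub.trans (Whitney.isBigO_sub_rpow hα₀ hα₁)

theorem holderAt_zero_iff {f : E → F} :
    HolderAt 0 α f x ↔ ContDiffAt ℝ 0 f x ∧
      (fun p : E × E => f p.1 - f p.2) =O[𝓝 (x, x)] fun p => ‖p.1 - p.2‖ ^ α := by
  have key : ∀ p : E × E, ‖iteratedFDeriv ℝ 0 f p.1 - iteratedFDeriv ℝ 0 f p.2‖
      = ‖f p.1 - f p.2‖ := fun p => by
    simp only [iteratedFDeriv_zero_eq_comp, Function.comp_apply, ← map_sub,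
      LinearIsometryEquiv.norm_map]
  constructor
  · rintro ⟨h1, h2⟩
    exact ⟨h1, (h2.norm_left.congr_left key).of_norm_left⟩
  · rintro ⟨h1, h2⟩
    exact ⟨h1, (h2.norm_left.congr_left fun p => (key p).symm).of_norm_left⟩

/-- The recursive description of the class `C^{k+1+α}` on which inductions on `k` rest. -/
theorem holderAt_succ_iff {f : E → F} :
    HolderAt (k + 1) α f x ↔
      (∀ᶠ y in 𝓝 x, DifferentiableAt ℝ f y) ∧ HolderAt k α (fderiv ℝ f) x := by
  have key : ∀ p : E × E, ‖iteratedFDeriv ℝ (k + 1) f p.1 - iteratedFDeriv ℝ (k + 1) f p.2‖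
      = ‖iteratedFDeriv ℝ k (fderiv ℝ f) p.1 - iteratedFDeriv ℝ k (fderiv ℝ f) p.2‖ := fun p => by
    simp [iteratedFDeriv_succ_eq_comp_right, ← dist_eq_norm_sub]
  constructor
  · rintro ⟨h1, h2⟩
    refine ⟨?_, h1.fderiv_right (by norm_cast), (h2.norm_left.congr_left key).of_norm_left⟩
    exact (h1.eventually (by simp)).mono fun y hy => hy.differentiableAt (by simp)
  · rintro ⟨h0, h1, h2⟩
    refine ⟨?_, (h2.norm_left.congr_left fun p => (key p).symm).of_norm_left⟩
    push_cast
    rw [contDiffAt_succ_iff_hasFDerivAt]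
    exact ⟨fderiv ℝ f, ⟨_, h0, fun y hy => hy.hasFDerivAt⟩, h1⟩

theorem _root_.ContDiffAt.holderAt {f : E → F} (hf : ContDiffAt ℝ (k + 1 : ℕ) f x)
    (hα₀ : 0 ≤ α) (hα₁ : α ≤ 1) : HolderAt k α f x :=
  ⟨hf.of_le (by norm_cast; omega),
    (hf.iteratedFDeriv_right (m := 1) (i := k) (by norm_cast; omega)).isBigO_sub_rpow hα₀ hα₁⟩

namespace HolderAt

theorem congr_of_eventuallyEq {f g : E → F} (hf : HolderAt k α f x) (h : f =ᶠ[𝓝 x] g) :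
    HolderAt k α g x := by
  refine ⟨hf.contDiffAt.congr_of_eventuallyEq h.symm, hf.isBigO.congr' ?_ .rfl⟩
  have h' := h.iteratedFDeriv ℝ k
  rw [nhds_prod_eq]
  filter_upwards [h'.prod_mk h'] with p hp
  rw [hp.1, hp.2]

theorem of_succ {f : E → F} (hf : HolderAt (k + 1) α f x) (hα₀ : 0 ≤ α) (hα₁ : α ≤ 1) :
    HolderAt k α f x :=
  hf.contDiffAt.holderAt hα₀ hα₁

theorem add {f g : E → F} (hf : HolderAt k α f x) (hg : HolderAt k α g x) :
    HolderAt k α (fun y => f y + g y) x := by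
  refine ⟨hf.contDiffAt.add hg.contDiffAt, (hf.isBigO.add hg.isBigO).congr' ?_ .rfl⟩
  have h1 := (hf.contDiffAt.eventually (by simp)).and (hg.contDiffAt.eventually (by simp))
  rw [nhds_prod_eq]
  filter_upwards [h1.prod_mk h1] with p hp
  rw [show (fun y => f y + g y) = f + g from rfl, iteratedFDeriv_add_apply hp.1.1 hp.1.2,
    iteratedFDeriv_add_apply hp.2.1 hp.2.2]
  abel

/-- A bounded bilinear expression in two `C^{k+α}` maps is `C^{k+α}`, by induction on `k` through
the product rule. -/
theorem bilinear (hα₀ : 0 ≤ α) (hα₁ : α ≤ 1) (B : F →L[ℝ] G →L[ℝ] H) {f : E → F} {g : E → G}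
    (hf : HolderAt k α f x) (hg : HolderAt k α g x) :
    HolderAt k α (fun y => B (f y) (g y)) x := by
  induction k generalizing F G H with
  | zero =>
    rw [holderAt_zero_iff] at *
    refine ⟨(B.contDiff.contDiffAt.comp x hf.1).clm_apply hg.1, ?_⟩
    have hf0 : (fun p : E × E => f p.2) =O[𝓝 (x, x)] fun _ => (1 : ℝ) :=
      ((hf.1.continuousAt.tendsto.comp (continuous_snd.tendsto (x, x))).isBigO_one ℝ)
    have hg0 : (fun p : E × E => g p.1) =O[𝓝 (x, x)] fun _ => (1 : ℝ) :=
      ((hg.1.continuousAt.tendsto.comp (continuous_fst.tendsto (x, x))).isBigO_one ℝ)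
    have hB : ∀ {u : E × E → F} {v : E × E → G},
        (fun p => B (u p) (v p)) =O[𝓝 (x, x)] fun p => ‖u p‖ * ‖v p‖ := fun {u v} =>
      IsBigO.of_bound ‖B‖ (Eventually.of_forall fun p => by
        simpa [mul_assoc] using B.le_opNorm₂ (u p) (v p))
    have h1 := (hB (u := fun p => f p.1 - f p.2) (v := fun p => g p.1)).trans
      (hf.2.norm_left.mul hg0.norm_left)
    have h2 := (hB (u := fun p => f p.2) (v := fun p => g p.1 - g p.2)).trans
      (hf0.norm_left.mul hg.2.norm_left)
    simp only [mul_one, one_mul] at h1 h2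
    refine (h1.add h2).congr_left fun p => ?_
    simp
  | succ k ih =>
    have hf' := hf.of_succ hα₀ hα₁
    have hg' := hg.of_succ hα₀ hα₁
    rw [holderAt_succ_iff] at *
    refine ⟨?_, ?_⟩
    · filter_upwards [hf.1, hg.1] with y h1 h2
      exact (B.hasFDerivAt_of_bilinear h1.hasFDerivAt h2.hasFDerivAt).differentiableAt
    · have h1 := (ih (B.precompR E) hf' hg.2).add (ih (B.precompL E) hf.2 hg')
      refine h1.congr_of_eventuallyEq ?_
      filter_upwards [hf.1, hg.1] with y h1 h2
      exact (B.fderiv_of_bilinear h1 h2).symm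

/-- Post-composition with a smooth map preserves the class `C^{k+α}`. -/
theorem comp_left (hα₀ : 0 ≤ α) (hα₁ : α ≤ 1) {f : E → F} {g : F → G}
    (hg : ContDiffAt ℝ ∞ g (f x)) (hf : HolderAt k α f x) : HolderAt k α (g ∘ f) x := by
  induction k generalizing G with
  | zero =>
    rw [holderAt_zero_iff] at *
    refine ⟨(hg.of_le (by simp)).comp x hf.1, ?_⟩
    have hc : Tendsto (Prod.map f f) (𝓝 (x, x)) (𝓝 (f x, f x)) :=
      hf.1.continuousAt.prodMap hf.1.continuousAt
    exact (((hg.of_le (by exact_mod_cast le_top)).hasStrictFDerivAt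
      one_ne_zero).isBigO_sub.comp_tendsto hc).trans hf.2
  | succ k ih =>
    have hf' := hf.of_succ hα₀ hα₁
    have hc : ContinuousAt f x := hf.contDiffAt.continuousAt
    rw [holderAt_succ_iff] at hf ⊢
    have hgd : ∀ᶠ y in 𝓝 x, DifferentiableAt ℝ g (f y) := hc.eventually
      (((hg.of_le (m := 1) (by exact_mod_cast le_top)).eventually (by simp)).mono
        fun z hz => hz.differentiableAt (by simp))
    refine ⟨?_, ?_⟩
    · filter_upwards [hf.1, hgd] with y h1 h2 using h2.comp y h1
    · refine (bilinear hα₀ hα₁ (ContinuousLinearMap.compL ℝ E F G)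
        (ih (hg.fderiv_right (m := ∞) (by simp)) hf') hf.2).congr_of_eventuallyEq ?_
      filter_upwards [hf.1, hgd] with y h1 h2
      simp [fderiv_comp y h2 h1]

/-- Pre-composition with a smooth map preserves the class `C^{k+α}`. -/
theorem comp_right (hα₀ : 0 ≤ α) (hα₁ : α ≤ 1) {f : E → F} {g : F → G}
    (hg : HolderAt k α g (f x)) (hf : ContDiffAt ℝ ∞ f x) : HolderAt k α (g ∘ f) x := by
  induction k generalizing G with
  | zero =>
    rw [holderAt_zero_iff] at *
    refine ⟨hg.1.comp x (hf.of_le (by simp)), ?_⟩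
    have hc : Tendsto (Prod.map f f) (𝓝 (x, x)) (𝓝 (f x, f x)) :=
      hf.continuousAt.prodMap hf.continuousAt
    refine (hg.2.comp_tendsto hc).trans ?_
    have h1 := ((hf.of_le (m := 1) (by exact_mod_cast le_top)).hasStrictFDerivAt
      one_ne_zero).isBigO_sub
    exact h1.norm_norm.rpow hα₀ (Eventually.of_forall fun p => norm_nonneg _)
  | succ k ih =>
    have hfd : ∀ᶠ y in 𝓝 x, DifferentiableAt ℝ f y :=
      ((hf.of_le (m := 1) (by exact_mod_cast le_top)).eventually (by simp)).mono
        fun z hz => hz.differentiableAt (by simp)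
    rw [holderAt_succ_iff] at hg ⊢
    have hgd := hf.continuousAt.eventually hg.1
    refine ⟨?_, ?_⟩
    · filter_upwards [hfd, hgd] with y h1 h2 using h2.comp y h1
    · refine (bilinear hα₀ hα₁ (ContinuousLinearMap.compL ℝ E F G) (ih hg.2)
        ((hf.fderiv_right (m := (k + 1 : ℕ)) (by exact_mod_cast le_top)).holderAt
          hα₀ hα₁)).congr_of_eventuallyEq ?_
      filter_upwards [hfd, hgd] with y h1 h2
      simp [fderiv_comp y h2 h1]

end HolderAt

end LocalHolder

/-! ### Pointwise bounds and geometrically convergent sequences -/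

section Bounds

variable {E F : Type*} [NormedAddCommGroup E] [NormedSpace ℝ E]
  [NormedAddCommGroup F] [NormedSpace ℝ F] {k : ℕ} {α c ε : ℝ} {A B : Set E} {u : E → F}

/-- The constant `c` bounds on `A` the derivatives of `u` of order at most `k` and, if `α ≠ 0`, the
`α`-Hölder quotients of the `k`-th derivative.  This is a real-valued counterpart of the inequality
`‖u‖_{k+α, A} ≤ c`, equivalent to it up to a factor `3`. -/
structure BoundedBy (k : ℕ) (α : ℝ) (A : Set E) (u : E → F) (c : ℝ) : Prop where
  deriv_le : ∀ i ≤ k, ∀ x ∈ A, ‖iteratedFDeriv ℝ i u x‖ ≤ c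
  holder_le : α ≠ 0 → ∀ x ∈ A, ∀ y ∈ A,
    ‖iteratedFDeriv ℝ k u x - iteratedFDeriv ℝ k u y‖ ≤ c * dist x y ^ α

theorem BoundedBy.norm_apply_le (h : BoundedBy k α A u c) {x : E} (hx : x ∈ A) : ‖u x‖ ≤ c := by
  simpa using h.deriv_le 0 (Nat.zero_le k) x hx

theorem BoundedBy.mono (h : BoundedBy k α A u c) (hB : B ⊆ A) : BoundedBy k α B u c :=
  ⟨fun i hi x hx => h.deriv_le i hi x (hB hx),
    fun hα x hx y hy => h.holder_le hα x (hB hx) y (hB hy)⟩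

theorem holderSeminorm_le_ofReal_iff {E G : Type*} [NormedAddCommGroup E] [NormedAddCommGroup G]
    {A : Set E} {g : E → G} (hc : 0 ≤ c) :
    holderSeminorm α A g ≤ ENNReal.ofReal c ↔
      ∀ x ∈ A, ∀ y ∈ A, ‖g x - g y‖ ≤ c * dist x y ^ α := by
  simp only [holderSeminorm, iSup_le_iff]
  refine forall₂_congr fun x _ => forall₂_congr fun y _ => ?_
  rcases eq_or_ne x y with rfl | hxy
  · simpa using mul_nonneg hc (Real.rpow_nonneg le_rfl α)
  · have hd : 0 < dist x y := dist_pos.2 hxy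
    have hp : 0 < dist x y ^ α := Real.rpow_pos_of_pos hd α
    rw [edist_dist, ENNReal.ofReal_rpow_of_pos hd, ENNReal.div_le_iff
      (by simpa using hp) ENNReal.ofReal_ne_top, ← ENNReal.ofReal_mul hc, ← ofReal_norm,
      ENNReal.ofReal_le_ofReal_iff (by positivity)]
    simp [hxy]

/-- The limit of a geometrically convergent sequence of `C^{k+α}` maps is `C^k`, and the distance
estimate passes to the limit. -/
theorem contDiffOn_and_boundedBy_of_geometric [CompleteSpace F] {h : ℕ → E → F} {g : E → F}
    (hc : ∀ j, ∀ x ∈ A, ContDiffAt ℝ k (h j) x)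
    (hb : ∀ j, BoundedBy k α A (h j - h (j + 1)) (ε / 2 ^ j))
    (hg : ∀ x ∈ A, Tendsto (fun j => h j x) atTop (𝓝 (g x))) :
    ContDiffOn ℝ k g (interior A) ∧ BoundedBy k α (interior A) (h 0 - g) (2 * ε) := by
  have hci : ∀ j, ∀ i ≤ k, ∀ x ∈ A, ContDiffAt ℝ i (h j) x := fun j i hi x hx =>
    (hc j x hx).of_le (by exact_mod_cast hi)
  have hdist : ∀ i ≤ k, ∀ x ∈ A, ∀ j,
      dist (iteratedFDeriv ℝ i (h j) x) (iteratedFDeriv ℝ i (h (j + 1)) x)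
        ≤ (2 * ε) / 2 / 2 ^ j := by
    intro i hi x hx j
    rw [dist_eq_norm, ← iteratedFDeriv_sub_apply (hci j i hi x hx) (hci (j + 1) i hi x hx),
      mul_div_cancel_left₀ ε two_ne_zero]
    exact (hb j).deriv_le i hi x hx
  have hlim : ∀ x i, ∃ a, x ∈ A ∧ i ≤ k →
      Tendsto (fun j => iteratedFDeriv ℝ i (h j) x) atTop (𝓝 a) := by
    intro x i
    by_cases hxi : x ∈ A ∧ i ≤ k
    · obtain ⟨a, ha⟩ := cauchySeq_tendsto_of_complete
        (cauchySeq_of_le_geometric_two (hdist i hxi.2 x hxi.1))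
      exact ⟨a, fun _ => ha⟩
    · exact ⟨0, fun hh => absurd hh hxi⟩
  -- the limits of the derivatives form a Taylor series for `g`
  choose p hp using hlim
  have hunif : ∀ i ≤ k, TendstoUniformlyOn (fun j => iteratedFDeriv ℝ i (h j)) (fun x => p x i)
      atTop A := by
    intro i hi
    rw [Metric.tendstoUniformlyOn_iff]
    intro δ hδ
    have h0 : Tendsto (fun j : ℕ => 2 * ε / 2 ^ j) atTop (𝓝 0) :=
      tendsto_const_nhds.div_atTop (tendsto_pow_atTop_atTop_of_one_lt one_lt_two)
    filter_upwards [h0.eventually_lt_const hδ] with j hj x hx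
    rw [dist_comm]
    exact (dist_le_of_le_geometric_two_of_tendsto (hdist i hi x hx) (hp x i ⟨hx, hi⟩) j).trans_lt hj
  have hA : interior A ⊆ A := interior_subset
  have hT : HasFTaylorSeriesUpToOn k g p (interior A) := by
    refine ⟨fun x hx => ?_, fun i hi x hx => ?_, fun i hi => ?_⟩
    · have h1 := ((continuousMultilinearCurryFin0 ℝ E F).continuous.tendsto _).comp
        (hp x 0 ⟨hA hx, Nat.zero_le k⟩)
      refine tendsto_nhds_unique h1 ((hg x (hA hx)).congr fun j => ?_)
      simp [iteratedFDeriv_zero_eq_comp]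
    · have hi : i < k := by exact_mod_cast hi
      refine (hasFDerivAt_of_tendstoUniformlyOn isOpen_interior
        (f := fun j => iteratedFDeriv ℝ i (h j))
        (f' := fun j x => (iteratedFDeriv ℝ (i + 1) (h j) x).curryLeft)
        (g' := fun x => (p x (i + 1)).curryLeft) ?_ (fun j y hy => ?_)
        (fun y hy => hp y i ⟨hA hy, hi.le⟩) hx).hasFDerivWithinAt
      · exact (continuousMultilinearCurryLeftEquiv ℝ (fun _ : Fin (i + 1) => E)
          F).isometry.uniformContinuous.comp_tendstoUniformlyOn ((hunif (i + 1) hi).mono hA)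
      · have hd := ((hci j (i + 1) hi y (hA hy)).iteratedFDeriv_right (m := 1) (i := i)
          (by norm_cast; omega)).differentiableAt one_ne_zero
        have := hd.hasFDerivAt
        rwa [fderiv_iteratedFDeriv] at this
    · have hi : i ≤ k := by exact_mod_cast hi
      refine ((hunif i hi).mono hA).continuousOn (Eventually.of_forall fun j => ?_).frequently
      exact fun x hx => ((hci j i hi x (hA hx)).continuousAt_iteratedFDeriv
        le_rfl).continuousWithinAt
  have hgc : ContDiffOn ℝ k g (interior A) := by
    have := HasFTaylorSeriesUpToOn.contDiffOn (n := (k : ℕ∞)) hT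
    exact_mod_cast this
  have hgi : ∀ i ≤ k, ∀ x ∈ interior A, ContDiffAt ℝ i g x := fun i hi x hx =>
    ((hgc x hx).contDiffAt (isOpen_interior.mem_nhds hx)).of_le (by exact_mod_cast hi)
  have hpg : ∀ i ≤ k, ∀ x ∈ interior A, iteratedFDeriv ℝ i g x = p x i := by
    intro i hi x hx
    rw [← iteratedFDerivWithin_of_isOpen i isOpen_interior hx]
    exact (hT.eq_iteratedFDerivWithin_of_uniqueDiffOn (by exact_mod_cast hi)
      isOpen_interior.uniqueDiffOn hx).symm
  have hsub : ∀ i ≤ k, ∀ x ∈ interior A,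
      iteratedFDeriv ℝ i (h 0 - g) x = iteratedFDeriv ℝ i (h 0) x - p x i := by
    intro i hi x hx
    rw [iteratedFDeriv_sub_apply (hci 0 i hi x (hA hx)) (hgi i hi x hx), hpg i hi x hx]
  refine ⟨hgc, fun i hi x hx => ?_, fun hα x hx y hy => ?_⟩
  · rw [hsub i hi x hx, ← dist_eq_norm]
    exact dist_le_of_le_geometric_two_of_tendsto₀ (hdist i hi x (hA hx)) (hp x i ⟨hA hx, hi⟩)
  · -- the Hölder quotients converge geometrically as well
    have hd : ∀ j, dist (iteratedFDeriv ℝ k (h j) x - iteratedFDeriv ℝ k (h j) y)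
        (iteratedFDeriv ℝ k (h (j + 1)) x - iteratedFDeriv ℝ k (h (j + 1)) y)
          ≤ (2 * ε * dist x y ^ α) / 2 / 2 ^ j := by
      intro j
      have := (hb j).holder_le hα x (hA hx) y (hA hy)
      rw [iteratedFDeriv_sub_apply (hc j x (hA hx)) (hc (j + 1) x (hA hx)),
        iteratedFDeriv_sub_apply (hc j y (hA hy)) (hc (j + 1) y (hA hy)), sub_sub_sub_comm] at this
      rw [dist_eq_norm]
      refine this.trans_eq ?_
      ring
    have := dist_le_of_le_geometric_two_of_tendsto₀ hd
      ((hp x k ⟨hA hx, le_rfl⟩).sub (hp y k ⟨hA hy, le_rfl⟩))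
    rwa [hsub k le_rfl x hx, hsub k le_rfl y hy, sub_sub_sub_comm, ← dist_eq_norm]

end Bounds

/-! ### Comparison of the norms with pointwise bounds -/

section Seminorms

variable {m d k : ℕ} {α c : ℝ} {A : Set (EuclideanSpace ℝ (Fin m))}
  {u v : EuclideanSpace ℝ (Fin m) → EuclideanSpace ℝ (Fin d)}

theorem ckLipSeminorm_eq : ckLipSeminorm (m := m) (d := d) k = ckHolderSeminorm k 1 := by
  funext K f
  simp [ckLipSeminorm, ckHolderSeminorm]

theorem boundedBy_of_norm_le (hc : 0 ≤ c)
    (h : (ckHolderSeminorm k α).norm A u ≤ ENNReal.ofReal c) : BoundedBy k α A u c := by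
  have h0 : supNorm A u ≤ ENNReal.ofReal c := le_self_add.trans h
  have h1 : ckHolderSeminorm k α A u ≤ ENNReal.ofReal c := le_add_self.trans h
  have h2 : ckSeminorm k A u ≤ ENNReal.ofReal c := by
    refine le_trans ?_ h1
    unfold ckHolderSeminorm
    split_ifs
    · exact le_rfl
    · exact le_self_add
  refine ⟨fun i hi x hx => ?_, fun hα => ?_⟩
  · rcases Nat.eq_zero_or_pos i with rfl | hi0
    · simp only [supNorm, iSup_le_iff] at h0
      have := h0 x hx
      rw [← ofReal_norm, ENNReal.ofReal_le_ofReal_iff hc] at this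
      simpa using this
    · simp only [ckSeminorm, iSup_le_iff] at h2
      have := h2 i ⟨hi0, hi⟩ x hx
      rwa [← ofReal_norm, ENNReal.ofReal_le_ofReal_iff hc] at this
  · refine (holderSeminorm_le_ofReal_iff hc).1 (le_trans ?_ h1)
    unfold ckHolderSeminorm
    rw [if_neg hα]
    exact le_add_self

theorem BoundedBy.norm_le (hc : 0 ≤ c) (h : BoundedBy k α A u c) :
    (ckHolderSeminorm k α).norm A u ≤ ENNReal.ofReal (3 * c) := by
  have h0 : supNorm A u ≤ ENNReal.ofReal c := by
    simp only [supNorm, iSup_le_iff]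
    intro x hx
    rw [← ofReal_norm]
    exact ENNReal.ofReal_le_ofReal (h.norm_apply_le hx)
  have h1 : ckSeminorm k A u ≤ ENNReal.ofReal c := by
    simp only [ckSeminorm, iSup_le_iff]
    intro i hi x hx
    rw [← ofReal_norm]
    exact ENNReal.ofReal_le_ofReal (h.deriv_le i hi.2 x hx)
  have h2 : ckHolderSeminorm k α A u ≤ ENNReal.ofReal c + ENNReal.ofReal c := by
    unfold ckHolderSeminorm
    split_ifs with hα
    · exact h1.trans le_self_add
    · exact add_le_add h1 ((holderSeminorm_le_ofReal_iff hc).2 (h.holder_le hα))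
  refine (add_le_add h0 h2).trans_eq ?_
  rw [← ENNReal.ofReal_add hc hc, ← ENNReal.ofReal_add hc (by positivity)]
  ring_nf

theorem norm_lt_top_iff : (ckHolderSeminorm k α).norm A u < ⊤ ↔ ∃ c, 0 ≤ c ∧ BoundedBy k α A u c :=
  ⟨fun h => ⟨_, ENNReal.toReal_nonneg, boundedBy_of_norm_le ENNReal.toReal_nonneg
    (ENNReal.ofReal_toReal h.ne).ge⟩,
    fun ⟨_, hc, h⟩ => (h.norm_le hc).trans_lt ENNReal.ofReal_lt_top⟩

theorem norm_zero : (ckHolderSeminorm k α).norm A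
    (0 : EuclideanSpace ℝ (Fin m) → EuclideanSpace ℝ (Fin d)) = 0 := by
  have h : BoundedBy k α A (0 : EuclideanSpace ℝ (Fin m) → EuclideanSpace ℝ (Fin d)) 0 :=
    ⟨by simp [Pi.zero_def], by simp [Pi.zero_def]⟩
  simpa using h.norm_le le_rfl

theorem holderSeminorm_add_le {X G : Type*} [MetricSpace X] [NormedAddCommGroup G] {K : Set X}
    (g g' : X → G) :
    holderSeminorm α K (g + g') ≤ holderSeminorm α K g + holderSeminorm α K g' := by
  unfold holderSeminorm
  refine iSup₂_le fun x hx => iSup₂_le fun y hy => iSup_le fun hxy => ?_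
  refine le_trans ?_ (add_le_add
    (le_iSup₂_of_le x hx (le_iSup₂_of_le y hy (le_iSup_of_le hxy le_rfl)))
    (le_iSup₂_of_le x hx (le_iSup₂_of_le y hy (le_iSup_of_le hxy le_rfl))))
  rw [← ENNReal.add_div]
  gcongr
  simpa [add_sub_add_comm] using enorm_add_le (g x - g y) (g' x - g' y)

theorem holderSeminorm_congr {X G : Type*} [MetricSpace X] [NormedAddCommGroup G] {K : Set X}
    {g g' : X → G} (h : EqOn g g' K) : holderSeminorm α K g = holderSeminorm α K g' := by
  unfold holderSeminorm
  refine iSup_congr fun x => iSup_congr fun hx => iSup_congr fun y => iSup_congr fun hy => ?_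
  rw [h hx, h hy]

theorem norm_add_le (hu : ∀ x ∈ A, ContDiffAt ℝ k u x) (hv : ∀ x ∈ A, ContDiffAt ℝ k v x) :
    (ckHolderSeminorm k α).norm A (u + v) ≤
      (ckHolderSeminorm k α).norm A u + (ckHolderSeminorm k α).norm A v := by
  have hadd : ∀ i ≤ k, EqOn (iteratedFDeriv ℝ i (u + v))
      (iteratedFDeriv ℝ i u + iteratedFDeriv ℝ i v) A := fun i hi x hx =>
    iteratedFDeriv_add_apply ((hu x hx).of_le (by exact_mod_cast hi))
      ((hv x hx).of_le (by exact_mod_cast hi))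
  have h0 : supNorm A (u + v) ≤ supNorm A u + supNorm A v := by
    unfold supNorm
    exact iSup₂_le fun x hx => (enorm_add_le _ _).trans
      (add_le_add (le_iSup₂_of_le x hx le_rfl) (le_iSup₂_of_le x hx le_rfl))
  have h1 : ckSeminorm k A (u + v) ≤ ckSeminorm k A u + ckSeminorm k A v := by
    unfold ckSeminorm
    refine iSup₂_le fun i hi => iSup₂_le fun x hx => ?_
    rw [hadd i hi.2 hx]
    exact (enorm_add_le _ _).trans
      (add_le_add (le_iSup₂_of_le i hi (le_iSup₂_of_le x hx le_rfl))
        (le_iSup₂_of_le i hi (le_iSup₂_of_le x hx le_rfl)))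
  have h2 : ckHolderSeminorm k α A (u + v) ≤
      ckHolderSeminorm k α A u + ckHolderSeminorm k α A v := by
    unfold ckHolderSeminorm
    split_ifs with hα
    · exact h1
    · rw [holderSeminorm_congr (hadd k le_rfl)]
      exact (add_le_add h1 (holderSeminorm_add_le _ _)).trans_eq (add_add_add_comm _ _ _ _)
  exact (add_le_add h0 h2).trans_eq (add_add_add_comm _ _ _ _)

/-- A map that is locally of class `C^{k+α}` at the points of a compact set has finite norm there.
Off the diagonal the Hölder quotients are bounded by continuity of the `k`-th derivative. -/
theorem norm_lt_top_of_holderAt (hA : IsCompact A) (hu : ∀ x ∈ A, HolderAt k α u x) :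
    (ckHolderSeminorm k α).norm A u < ⊤ := by
  rw [norm_lt_top_iff]
  have h1 : ∀ i ≤ k, ∃ c, 0 ≤ c ∧ ∀ x ∈ A, ‖iteratedFDeriv ℝ i u x‖ ≤ c := by
    intro i hi
    have hcont : ContinuousOn (iteratedFDeriv ℝ i u) A := fun x hx =>
      ((hu x hx).contDiffAt.continuousAt_iteratedFDeriv (by exact_mod_cast hi)).continuousWithinAt
    obtain ⟨c, hc⟩ := hA.exists_bound_of_continuousOn hcont
    exact ⟨max c 0, le_max_right _ _, fun x hx => (hc x hx).trans (le_max_left _ _)⟩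
  have h2 : ∃ c, 0 ≤ c ∧ ∀ p ∈ A ×ˢ A,
      ‖iteratedFDeriv ℝ k u p.1 - iteratedFDeriv ℝ k u p.2‖ ≤ c * dist p.1 p.2 ^ α := by
    refine (hA.prod hA).induction_on
      (p := fun s => ∃ c, 0 ≤ c ∧ ∀ p ∈ s,
        ‖iteratedFDeriv ℝ k u p.1 - iteratedFDeriv ℝ k u p.2‖ ≤ c * dist p.1 p.2 ^ α)
      ⟨0, le_rfl, by simp⟩ ?_ ?_ ?_
    · rintro s t hst ⟨c, hc, h⟩
      exact ⟨c, hc, fun p hp => h p (hst hp)⟩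
    · rintro s t ⟨c, hc, h⟩ ⟨c', hc', h'⟩
      refine ⟨max c c', hc.trans (le_max_left _ _), ?_⟩
      rintro p (hp | hp)
      · exact (h p hp).trans (by gcongr; exact le_max_left _ _)
      · exact (h' p hp).trans (by gcongr; exact le_max_right _ _)
    · rintro ⟨x, y⟩ ⟨hx, hy⟩
      suffices h : ∃ c, 0 ≤ c ∧ ∀ᶠ p : EuclideanSpace ℝ (Fin m) × EuclideanSpace ℝ (Fin m) in
          𝓝 (x, y), ‖iteratedFDeriv ℝ k u p.1 - iteratedFDeriv ℝ k u p.2‖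
            ≤ c * dist p.1 p.2 ^ α by
        obtain ⟨c, hc, h⟩ := h
        exact ⟨_, mem_nhdsWithin_of_mem_nhds h, c, hc, fun p hp => hp⟩
      rcases eq_or_ne x y with rfl | hxy
      · obtain ⟨c, hc, h⟩ := (hu x hx).isBigO.exists_nonneg
        refine ⟨c, hc, h.bound.mono fun p hp => ?_⟩
        rwa [Real.norm_of_nonneg (by positivity), ← dist_eq_norm p.1] at hp
      · have hd : 0 < dist x y ^ α := Real.rpow_pos_of_pos (dist_pos.2 hxy) α
        have hn : ContinuousAt (fun p : EuclideanSpace ℝ (Fin m) × EuclideanSpace ℝ (Fin m) =>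
            ‖iteratedFDeriv ℝ k u p.1 - iteratedFDeriv ℝ k u p.2‖) (x, y) :=
          (((hu x hx).contDiffAt.continuousAt_iteratedFDeriv le_rfl).comp
            (f := Prod.fst) (x := (x, y)) continuousAt_fst |>.sub
            (((hu y hy).contDiffAt.continuousAt_iteratedFDeriv le_rfl).comp
            (f := Prod.snd) (x := (x, y)) continuousAt_snd)).norm
        have hq : ContinuousAt (fun p : EuclideanSpace ℝ (Fin m) × EuclideanSpace ℝ (Fin m) =>
            dist p.1 p.2 ^ α) (x, y) :=
          (continuousAt_fst.dist continuousAt_snd).rpow_const (Or.inl (dist_pos.2 hxy).ne')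
        set b := ‖iteratedFDeriv ℝ k u x - iteratedFDeriv ℝ k u y‖ + 1 with hb
        refine ⟨b / (dist x y ^ α / 2), by positivity, ?_⟩
        filter_upwards [hn.eventually_lt (continuousAt_const (y := b)) (by simp [hb]),
          (continuousAt_const (y := dist x y ^ α / 2)).eventually_lt hq (half_lt_self hd)]
          with p hp1 hp2
        rw [div_mul_eq_mul_div, le_div_iff₀ (by positivity)]
        have : 0 ≤ b := by positivity
        exact mul_le_mul hp1.le hp2.le (by positivity) this
  obtain ⟨c, hc, h2⟩ := h2
  choose! C hC0 hC using h1
  have hS : ∀ i ≤ k, C i ≤ ∑ i ∈ Finset.range (k + 1), C i := fun i hi =>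
    Finset.single_le_sum (f := C) (fun j hj => hC0 j (by simpa [Nat.lt_succ_iff] using hj))
      (by simpa [Nat.lt_succ_iff] using hi)
  have hS0 := (hC0 0 (Nat.zero_le k)).trans (hS 0 (Nat.zero_le k))
  refine ⟨(∑ i ∈ Finset.range (k + 1), C i) + c, by positivity, fun i hi x hx => ?_,
    fun _ x hx y hy => ?_⟩
  · linarith [hC i hi x hx, hS i hi]
  · refine (h2 (x, y) ⟨hx, hy⟩).trans ?_
    gcongr
    linarith

/-- Conversely, a `C^k` map with a norm bound on a neighbourhood of `x` is of class `C^{k+α}`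
near `x`. -/
theorem BoundedBy.holderAt {x : EuclideanSpace ℝ (Fin m)} (h : BoundedBy k α A u c)
    (hu : ContDiffAt ℝ k u x) (hx : A ∈ 𝓝 x) : HolderAt k α u x := by
  refine ⟨hu, ?_⟩
  rcases eq_or_ne α 0 with rfl | hα
  · have hc := hu.continuousAt_iteratedFDeriv (le_refl (k : WithTop ℕ∞))
    have := (hc.comp (f := Prod.fst) (x := (x, x)) continuousAt_fst).sub
      (hc.comp (f := Prod.snd) (x := (x, x)) continuousAt_snd)
    simpa using this.tendsto.isBigO_one ℝ
  · refine Asymptotics.IsBigO.of_bound c ?_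
    filter_upwards [prod_mem_nhds hx hx] with p hp
    rw [Real.norm_of_nonneg (by positivity), ← dist_eq_norm p.1]
    exact h.holder_le hα p.1 hp.1 p.2 hp.2

end Seminorms

/-! ### Local representatives of maps between manifolds -/

section LocalRepresentatives

variable {m d : ℕ}
  {M : Type*} [TopologicalSpace M] [ChartedSpace (EuclideanSpace ℝ (Fin m)) M]
  {N : Type*} [TopologicalSpace N] [ChartedSpace (EuclideanSpace ℝ (Fin d)) N]
  {φ φ' : OpenPartialHomeomorph M (EuclideanSpace ℝ (Fin m))}
  {ψ ψ' : OpenPartialHomeomorph N (EuclideanSpace ℝ (Fin d))}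
  {f g : M → N} {k : ℕ} {α : ℝ} {x : M} {K : Set M}

theorem contDiffAt_chart_comp [IsManifold (𝓡 m) ∞ M] [IsManifold (𝓡 d) ∞ N]
    (hφ : φ ∈ IsManifold.maximalAtlas (𝓡 m) ∞ M) (hψ : ψ ∈ IsManifold.maximalAtlas (𝓡 d) ∞ N)
    (hf : ContMDiffAt (𝓡 m) (𝓡 d) k f x) (hx : x ∈ φ.source) (hfx : f x ∈ ψ.source) :
    ContDiffAt ℝ k (ψ ∘ f ∘ φ.symm) (φ x) := by
  rw [← contMDiffAt_iff_contDiffAt]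
  have hk : (k : WithTop ℕ∞) ≤ ((⊤ : ℕ∞) : WithTop ℕ∞) := by exact_mod_cast le_top
  have h1 : ContMDiffAt (𝓡 m) (𝓡 m) k φ.symm (φ x) :=
    (contMDiffAt_symm_of_mem_maximalAtlas hφ (φ.map_source hx)).of_le hk
  have h3 : ContMDiffAt (𝓡 d) (𝓡 d) k ψ (f x) :=
    (contMDiffAt_of_mem_maximalAtlas hψ hfx).of_le hk
  have hxx : φ.symm (φ x) = x := φ.left_inv hx
  refine ContMDiffAt.comp (φ x) (I' := 𝓡 d) (by simpa [hxx] using h3) ?_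
  exact ContMDiffAt.comp (φ x) (I' := 𝓡 m) (by simpa [hxx] using hf) h1

theorem contMDiffAt_of_contDiffAt_chart_comp [IsManifold (𝓡 m) ∞ M] [IsManifold (𝓡 d) ∞ N]
    (hφ : φ ∈ IsManifold.maximalAtlas (𝓡 m) ∞ M) (hψ : ψ ∈ IsManifold.maximalAtlas (𝓡 d) ∞ N)
    (hf : ContDiffAt ℝ k (ψ ∘ f ∘ φ.symm) (φ x)) (hx : x ∈ φ.source)
    (hfx : ∀ᶠ y in 𝓝 x, f y ∈ ψ.source) :
    ContMDiffAt (𝓡 m) (𝓡 d) k f x := by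
  have hk : (k : WithTop ℕ∞) ≤ ((⊤ : ℕ∞) : WithTop ℕ∞) := by exact_mod_cast le_top
  have hxx : φ.symm (φ x) = x := φ.left_inv hx
  have h1 : ContMDiffAt (𝓡 m) (𝓡 m) k φ x := (contMDiffAt_of_mem_maximalAtlas hφ hx).of_le hk
  have h3 : ContMDiffAt (𝓡 d) (𝓡 d) k ψ.symm (ψ (f x)) :=
    (contMDiffAt_symm_of_mem_maximalAtlas hψ (ψ.map_source hfx.self_of_nhds)).of_le hk
  have h2 := contMDiffAt_iff_contDiffAt.2 hf
  have h4 : ContMDiffAt (𝓡 m) (𝓡 d) k (ψ.symm ∘ (ψ ∘ f ∘ φ.symm) ∘ φ) x := by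
    refine ContMDiffAt.comp x (I' := 𝓡 d) (by simpa [hxx] using h3) ?_
    exact ContMDiffAt.comp x (I' := 𝓡 m) h2 h1
  refine h4.congr_of_eventuallyEq ?_
  filter_upwards [hfx, φ.open_source.mem_nhds hx] with y hy hy'
  simp [φ.left_inv hy', ψ.left_inv hy]

/-- Two charts of a smooth manifold differ by a smooth map. -/
theorem contDiffAt_chart_transition {n : ℕ} {X : Type*} [TopologicalSpace X]
    [ChartedSpace (EuclideanSpace ℝ (Fin n)) X] [IsManifold (𝓡 n) ∞ X]
    {e e' : OpenPartialHomeomorph X (EuclideanSpace ℝ (Fin n))} {x : X}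
    (he : e ∈ IsManifold.maximalAtlas (𝓡 n) ∞ X) (he' : e' ∈ IsManifold.maximalAtlas (𝓡 n) ∞ X)
    (hx : x ∈ e.source) (hx' : x ∈ e'.source) : ContDiffAt ℝ ∞ (e' ∘ e.symm) (e x) := by
  rw [← contMDiffAt_iff_contDiffAt]
  have hxx : e.symm (e x) = x := e.left_inv hx
  exact ContMDiffAt.comp (e x) (I' := 𝓡 n)
    (by simpa [hxx] using contMDiffAt_of_mem_maximalAtlas he' hx')
    (contMDiffAt_symm_of_mem_maximalAtlas he (e.map_source hx))

/-- Being of class `C^{k+α}` near a point does not depend on the charts. -/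
theorem HolderAt.change_charts [IsManifold (𝓡 m) ∞ M] [IsManifold (𝓡 d) ∞ N]
    (hα₀ : 0 ≤ α) (hα₁ : α ≤ 1)
    (hφ : φ ∈ IsManifold.maximalAtlas (𝓡 m) ∞ M) (hφ' : φ' ∈ IsManifold.maximalAtlas (𝓡 m) ∞ M)
    (hψ : ψ ∈ IsManifold.maximalAtlas (𝓡 d) ∞ N) (hψ' : ψ' ∈ IsManifold.maximalAtlas (𝓡 d) ∞ N)
    (hx : x ∈ φ.source) (hx' : x ∈ φ'.source) (hfx : f x ∈ ψ.source) (hfx' : f x ∈ ψ'.source)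
    (hc : ContinuousAt f x) (h : HolderAt k α (ψ ∘ f ∘ φ.symm) (φ x)) :
    HolderAt k α (ψ' ∘ f ∘ φ'.symm) (φ' x) := by
  have e1 : φ'.symm (φ' x) = x := φ'.left_inv hx'
  have e2 : φ.symm (φ x) = x := φ.left_inv hx
  have h1 : HolderAt k α ((ψ' ∘ ψ.symm) ∘ (ψ ∘ f ∘ φ.symm)) (φ x) :=
    h.comp_left hα₀ hα₁ (by simpa [e2] using contDiffAt_chart_transition hψ hψ' hfx hfx')
  have h2 : HolderAt k α (((ψ' ∘ ψ.symm) ∘ (ψ ∘ f ∘ φ.symm)) ∘ (φ ∘ φ'.symm)) (φ' x) :=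
    HolderAt.comp_right hα₀ hα₁ (by simpa [e1] using h1)
      (contDiffAt_chart_transition hφ' hφ hx' hx)
  refine h2.congr_of_eventuallyEq ?_
  have hs : Tendsto φ'.symm (𝓝 (φ' x)) (𝓝 x) := by
    simpa [e1] using (φ'.continuousAt_symm (φ'.map_source hx')).tendsto
  filter_upwards [hs.eventually (φ.open_source.mem_nhds hx),
    hs.eventually (hc.eventually (ψ.open_source.mem_nhds hfx))] with y hy hy'
  have hy : φ'.symm y ∈ φ.source := hy
  have hy' : f (φ'.symm y) ∈ ψ.source := hy'
  simp [φ.left_inv hy, ψ.left_inv hy']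

/-- Finiteness of the norms in all charts follows from local `C^{k+α}` regularity in one pair of
charts around every point. -/
theorem mem_maps_of_holderAt [IsManifold (𝓡 m) ∞ M] [IsManifold (𝓡 d) ∞ N]
    (hα₀ : 0 ≤ α) (hα₁ : α ≤ 1) (hf : ContMDiff (𝓡 m) (𝓡 d) k f)
    (h : ∀ x, ∃ (φ : OpenPartialHomeomorph M (EuclideanSpace ℝ (Fin m)))
      (ψ : OpenPartialHomeomorph N (EuclideanSpace ℝ (Fin d))),
      φ ∈ IsManifold.maximalAtlas (𝓡 m) ∞ M ∧ ψ ∈ IsManifold.maximalAtlas (𝓡 d) ∞ N ∧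
      x ∈ φ.source ∧ f x ∈ ψ.source ∧ HolderAt k α (ψ ∘ f ∘ φ.symm) (φ x)) :
    f ∈ maps M N k (ckHolderSeminorm (m := m) (d := d) k α) := by
  refine ⟨hf, fun φ ψ K hK hfK => ?_⟩
  refine norm_lt_top_of_holderAt
    (hK.isCompact.image_of_continuousOn (φ.continuousOn.mono hK.subset_source)) ?_
  rintro _ ⟨x, hx, rfl⟩
  obtain ⟨φ', ψ', hφ', hψ', hx', hfx', hh⟩ := h x
  exact hh.change_charts hα₀ hα₁ hφ' hK.source_mem hψ' hK.target_mem hx' (hK.subset_source hx)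
    hfx' (hfK hx) hf.continuous.continuousAt

theorem image_interior_subset {M : Type*} [TopologicalSpace M] {K : Set M}
    (φ : OpenPartialHomeomorph M (EuclideanSpace ℝ (Fin m)))
    (hK : K ⊆ φ.source) : φ '' interior K ⊆ interior (φ '' K) :=
  interior_maximal (image_mono interior_subset)
    (φ.isOpen_image_of_subset_source isOpen_interior (interior_subset.trans hK))

theorem contDiffAt_of_mem_maps [IsManifold (𝓡 m) ∞ M] [IsManifold (𝓡 d) ∞ N]
    {S : SeminormFamily m d} (hf : f ∈ maps M N k S) (hK : ChartData φ ψ K)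
    (hfK : MapsTo f K ψ.source) : ∀ y ∈ φ '' K, ContDiffAt ℝ k (ψ ∘ f ∘ φ.symm) y := by
  rintro _ ⟨x, hx, rfl⟩
  exact contDiffAt_chart_comp hK.source_mem hK.target_mem (hf.1 x) (hK.subset_source hx) (hfK hx)

end LocalRepresentatives

/-! ### Families of chart data and limits -/

section ChartFamilies

/-- The data of a basic neighbourhood of the strong topology, without the centre: an indexed family
of charts `φ t` of `M`, charts `ψ t` of `N`, subsets `K t` of `M` and radii `ε t`.  The radii are
real numbers, which suffices to describe neighbourhood bases. -/
structure ChartFamily (m d : ℕ) (M N : Type*) [TopologicalSpace M] [TopologicalSpace N] where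
  /-- the index type -/
  T : Type
  /-- the charts of the source -/
  φ : T → OpenPartialHomeomorph M (EuclideanSpace ℝ (Fin m))
  /-- the charts of the target -/
  ψ : T → OpenPartialHomeomorph N (EuclideanSpace ℝ (Fin d))
  /-- the subsets of the chart domains -/
  K : T → Set M
  /-- the radii -/
  ε : T → ℝ

variable {m d : ℕ} {M N : Type*} [TopologicalSpace M] [TopologicalSpace N] {k : ℕ} {α : ℝ}

namespace ChartFamily

variable {D D' : ChartFamily m d M N} {f g : M → N}

/-- `g` maps each `K t` into the domain of `ψ t`, and is at distance at most `2 ε t` from `f` on the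
interior of `K t`.  Uniform limits are known to be differentiable on the interior only. -/
def Near (D : ChartFamily m d M N) (k : ℕ) (α : ℝ) (f g : M → N) : Prop :=
  ∀ t, MapsTo g (D.K t) (D.ψ t).source ∧ BoundedBy k α (D.φ t '' interior (D.K t))
    (D.ψ t ∘ f ∘ (D.φ t).symm - D.ψ t ∘ g ∘ (D.φ t).symm) (2 * D.ε t)

/-- The disjoint union of two families. -/
def sum (D D' : ChartFamily m d M N) : ChartFamily m d M N where
  T := D.T ⊕ D'.T
  φ := Sum.elim D.φ D'.φ
  ψ := Sum.elim D.ψ D'.ψ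
  K := Sum.elim D.K D'.K
  ε := Sum.elim D.ε D'.ε

/-- The family with the same charts but other sets and radii. -/
def withData (D : ChartFamily m d M N) (K : D.T → Set M) (ε : D.T → ℝ) : ChartFamily m d M N where
  T := D.T
  φ := D.φ
  ψ := D.ψ
  K := K
  ε := ε

theorem Near.of_sum_left (h : (D.sum D').Near k α f g) : D.Near k α f g := fun t => h (Sum.inl t)

theorem Near.of_sum_right (h : (D.sum D').Near k α f g) : D'.Near k α f g := fun t => h (Sum.inr t)

end ChartFamily

variable [ChartedSpace (EuclideanSpace ℝ (Fin m)) M] [ChartedSpace (EuclideanSpace ℝ (Fin d)) N]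

namespace ChartFamily

variable {D D' : ChartFamily m d M N} {f : M → N}

/-- The basic neighbourhood with centre `f` given by a family of chart data. -/
def ball {S : SeminormFamily m d} (D : ChartFamily m d M N) (f : maps M N k S) :
    Set (maps M N k S) :=
  {g | ∀ t, g ∈ nhd f (D.φ t) (D.ψ t) (D.K t) (ENNReal.ofReal (D.ε t))}

/-- The family is admissible as the data of a basic neighbourhood of `f`. -/
def Valid (D : ChartFamily m d M N) (f : M → N) : Prop :=
  ∀ t, ChartData (D.φ t) (D.ψ t) (D.K t) ∧ MapsTo f (D.K t) (D.ψ t).source ∧ 0 < D.ε t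

/-- The family is admissible and the closed `2 ε t`-neighbourhood of the image of `K t` is contained
in the target of the chart `ψ t`, so that limits of maps at distance at most `2 ε t` from `f` still
map `K t` into the domain of `ψ t`. -/
def Good (D : ChartFamily m d M N) (f : M → N) : Prop :=
  D.Valid f ∧ ∀ t, ∀ x ∈ D.K t, ∀ y, dist y (D.ψ t (f x)) ≤ 2 * D.ε t → y ∈ (D.ψ t).target

/-- `D'` contains all members of `D`, with radii at most half as large. -/
def Refines (D' D : ChartFamily m d M N) : Prop :=
  ∀ t, ∃ t', D'.φ t' = D.φ t ∧ D'.ψ t' = D.ψ t ∧ D'.K t' = D.K t ∧ D'.ε t' ≤ D.ε t / 2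

/-- The interiors of the sets `K t` cover `A`. -/
def Covers (D : ChartFamily m d M N) (A : Set M) : Prop :=
  ∀ x ∈ A, ∃ t, x ∈ interior (D.K t)

theorem Valid.sum (h : D.Valid f) (h' : D'.Valid f) : (D.sum D').Valid f := by
  rintro (t | t)
  exacts [h t, h' t]

theorem Good.sum (h : D.Good f) (h' : D'.Good f) : (D.sum D').Good f := by
  refine ⟨h.1.sum h'.1, ?_⟩
  rintro (t | t)
  exacts [h.2 t, h'.2 t]

theorem ball_sum {S : SeminormFamily m d} (f : maps M N k S) :
    (D.sum D').ball f = D.ball f ∩ D'.ball f := by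
  ext g
  exact Sum.forall

theorem self_mem_ball (f : maps M N k (ckHolderSeminorm k α)) (h : D.Valid f.1) : f ∈ D.ball f := by
  intro t
  refine ⟨(h t).2.1, ?_⟩
  rw [sub_self, norm_zero]
  exact ENNReal.ofReal_pos.2 (h t).2.2

theorem boundedBy_of_mem_ball {f g : maps M N k (ckHolderSeminorm k α)} (h : g ∈ D.ball f)
    (t : D.T) (hε : 0 ≤ D.ε t) : BoundedBy k α (D.φ t '' D.K t)
      (D.ψ t ∘ f.1 ∘ (D.φ t).symm - D.ψ t ∘ g.1 ∘ (D.φ t).symm) (D.ε t) :=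
  boundedBy_of_norm_le hε (h t).2.le

/-- Recentring a good family at a member of its ball, with half the radii. -/
theorem Good.half {f g : maps M N k (ckHolderSeminorm k α)} (h : D.Good f.1) (hg : g ∈ D.ball f) :
    (D.withData D.K fun t => D.ε t / 2).Good g.1 := by
  refine ⟨fun t => ⟨(h.1 t).1, (hg t).1, half_pos (h.1 t).2.2⟩, fun t x hx y hy => ?_⟩
  have hx' : x ∈ D.K t := hx
  have hy' : dist y (D.ψ t (g.1 x)) ≤ 2 * (D.ε t / 2) := hy
  have h1 := (boundedBy_of_mem_ball hg t (h.1 t).2.2.le).norm_apply_le (mem_image_of_mem _ hx')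
  have h2 : ‖D.ψ t (f.1 x) - D.ψ t (g.1 x)‖ ≤ D.ε t := by
    simpa [(D.φ t).left_inv ((h.1 t).1.subset_source hx')] using h1
  rw [← dist_eq_norm] at h2
  refine h.2 t x hx' y ?_
  have := dist_triangle_right y (D.ψ t (f.1 x)) (D.ψ t (g.1 x))
  linarith

end ChartFamily

/-- A compact set in a chart domain may be enlarged to a compact neighbourhood on which a small
`C⁰`-neighbourhood of `f` stays in the target chart. -/
theorem ChartData.exists_enlargement [LocallyCompactSpace M]
    {φ : OpenPartialHomeomorph M (EuclideanSpace ℝ (Fin m))}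
    {ψ : OpenPartialHomeomorph N (EuclideanSpace ℝ (Fin d))} {K : Set M} {f : M → N}
    (h : ChartData φ ψ K) (hf : Continuous f) (hfK : MapsTo f K ψ.source) {ε : ℝ} (hε : 0 < ε) :
    ∃ (K' : Set M) (δ : ℝ), ChartData φ ψ K' ∧ MapsTo f K' ψ.source ∧ 0 < δ ∧ 6 * δ < ε ∧
      K ⊆ interior K' ∧ ∀ x ∈ K', ∀ y, dist y (ψ (f x)) ≤ 2 * δ → y ∈ ψ.target := by
  obtain ⟨K', hK', hKK', hsub⟩ := exists_compact_between h.isCompact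
    (φ.open_source.inter (ψ.open_source.preimage hf)) (fun x hx => ⟨h.subset_source hx, hfK hx⟩)
  have hmaps : MapsTo f K' ψ.source := fun x hx => (hsub hx).2
  have hcomp : IsCompact ((ψ ∘ f) '' K') :=
    hK'.image_of_continuousOn (ψ.continuousOn.comp hf.continuousOn hmaps)
  obtain ⟨η, hη, hηsub⟩ := hcomp.exists_cthickening_subset_open ψ.open_target
    (by rintro _ ⟨x, hx, rfl⟩; exact ψ.map_source (hmaps hx))
  refine ⟨K', min (η / 2) (ε / 7), ⟨h.source_mem, h.target_mem, hK', fun x hx => (hsub hx).1⟩,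
    hmaps, by positivity, ?_, hKK', fun x hx y hy => hηsub ?_⟩
  · linarith [min_le_right (η / 2) (ε / 7)]
  · refine Metric.mem_cthickening_of_dist_le y (ψ (f x)) η _ (mem_image_of_mem _ hx) ?_
    linarith [min_le_left (η / 2) (ε / 7)]

namespace ChartFamily

/-- Each basic neighbourhood of `f` contains all maps near `f` with respect to some good family with
the same charts. -/
theorem Valid.exists_good [LocallyCompactSpace M] {D : ChartFamily m d M N}
    {f : maps M N k (ckHolderSeminorm k α)} (h : D.Valid f.1) :
    ∃ (K' : D.T → Set M) (δ : D.T → ℝ), (D.withData K' δ).Good f.1 ∧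
      ∀ g : maps M N k (ckHolderSeminorm k α), (D.withData K' δ).Near k α f.1 g.1 →
        g ∈ D.ball f := by
  -- the norm is at most three times a pointwise bound `2 δ t`, whence the condition `6 δ t < ε t`
  choose K' δ h1 h2 h3 h4 h5 h6 using fun t =>
    (h t).1.exists_enlargement f.2.1.continuous (h t).2.1 (h t).2.2
  refine ⟨K', δ, ⟨fun t => ⟨h1 t, h2 t, h3 t⟩, h6⟩, fun g hg t => ?_⟩
  obtain ⟨hg1, hg2⟩ := hg t
  refine ⟨fun x hx => hg1 (interior_subset (h5 t hx)), ?_⟩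
  have hb := BoundedBy.norm_le (mul_nonneg zero_le_two (h3 t).le) (hg2.mono (image_mono (h5 t)))
  refine hb.trans_lt ?_
  change ENNReal.ofReal (3 * (2 * δ t)) < ENNReal.ofReal (D.ε t)
  rw [ENNReal.ofReal_lt_ofReal_iff (h t).2.2]
  linarith [h4 t]

theorem exists_good_covers [LocallyCompactSpace M] [IsManifold (𝓡 m) ∞ M] [IsManifold (𝓡 d) ∞ N]
    {f : M → N} (hf : Continuous f) {A : Set M} (hA : IsCompact A) :
    ∃ D : ChartFamily m d M N, Finite D.T ∧ D.Good f ∧ D.Covers A := by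
  refine hA.induction_on
    (p := fun A => ∃ D : ChartFamily m d M N, Finite D.T ∧ D.Good f ∧ D.Covers A) ?_ ?_ ?_ ?_
  · exact ⟨⟨Empty, Empty.elim, Empty.elim, Empty.elim, Empty.elim⟩, inferInstanceAs (Finite Empty),
      ⟨fun t => t.elim, fun t => t.elim⟩, fun x hx => hx.elim⟩
  · rintro s t hst ⟨D, h1, h2, h3⟩
    exact ⟨D, h1, h2, fun x hx => h3 x (hst hx)⟩
  · rintro s t ⟨D, h1, h2, h3⟩ ⟨D', h1', h2', h3'⟩
    refine ⟨D.sum D', inferInstanceAs (Finite (D.T ⊕ D'.T)), h2.sum h2', ?_⟩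
    rintro x (hx | hx)
    · obtain ⟨t, ht⟩ := h3 x hx
      exact ⟨Sum.inl t, ht⟩
    · obtain ⟨t, ht⟩ := h3' x hx
      exact ⟨Sum.inr t, ht⟩
  · intro x _
    have hx : ChartData (chartAt (EuclideanSpace ℝ (Fin m)) x)
        (chartAt (EuclideanSpace ℝ (Fin d)) (f x)) {x} :=
      ⟨IsManifold.chart_mem_maximalAtlas x, IsManifold.chart_mem_maximalAtlas (f x),
        isCompact_singleton, by simp⟩
    obtain ⟨K', δ, h1, h2, h3, -, h5, h6⟩ := hx.exists_enlargement hf (by simp) one_pos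
    refine ⟨_, mem_nhdsWithin_of_mem_nhds (isOpen_interior.mem_nhds (h5 rfl)),
      ⟨Unit, fun _ => chartAt _ x, fun _ => chartAt _ (f x), fun _ => K', fun _ => δ⟩,
      inferInstanceAs (Finite Unit), ⟨fun _ => ⟨h1, h2, h3⟩, fun _ => h6⟩,
      fun y hy => ⟨(), hy⟩⟩

/-- Completeness: a sequence of maps, each in the ball of its predecessor for families which refine
each other and whose compact sets exhaust `M`, has a limit in `C^{k+α}(M, N)`, near to every member
of the sequence. -/
theorem exists_limit [T2Space N] [IsManifold (𝓡 m) ∞ M] [IsManifold (𝓡 d) ∞ N]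
    (hα₀ : 0 ≤ α) (hα₁ : α ≤ 1)
    {f : ℕ → maps M N k (ckHolderSeminorm k α)} {D : ℕ → ChartFamily m d M N}
    (hgood : ∀ n, (D n).Good (f n).1) (href : ∀ n, (D (n + 1)).Refines (D n))
    (hball : ∀ n, f (n + 1) ∈ (D n).ball (f n)) (hcov : ∀ x, ∃ n t, x ∈ interior ((D n).K t)) :
    ∃ g : maps M N k (ckHolderSeminorm (m := m) (d := d) k α),
      ∀ n, (D n).Near k α (f n).1 g.1 := by
  -- each member of `D n` persists in `D (n + j)`, with its radius divided by `2 ^ j`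
  have hctl : ∀ n (t : (D n).T) j, ∃ t' : (D (n + j)).T, (D (n + j)).φ t' = (D n).φ t ∧
      (D (n + j)).ψ t' = (D n).ψ t ∧ (D (n + j)).K t' = (D n).K t ∧
      (D (n + j)).ε t' ≤ (D n).ε t / 2 ^ j := by
    intro n t j
    induction j with
    | zero => exact ⟨t, rfl, rfl, rfl, by simp⟩
    | succ j ih =>
      obtain ⟨t', h1, h2, h3, h4⟩ := ih
      obtain ⟨t'', h1', h2', h3', h4'⟩ := href (n + j) t'
      refine ⟨t'', h1'.trans h1, h2'.trans h2, h3'.trans h3, h4'.trans ?_⟩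
      rw [pow_succ, ← div_div]
      linarith
  have hmaps : ∀ n (t : (D n).T) j, MapsTo (f (n + j)).1 ((D n).K t) ((D n).ψ t).source := by
    intro n t j
    obtain ⟨t', -, h2, h3, -⟩ := hctl n t j
    rw [← h2, ← h3]
    exact ((hgood (n + j)).1 t').2.1
  have hb : ∀ n (t : (D n).T) j, BoundedBy k α ((D n).φ t '' (D n).K t)
      ((D n).ψ t ∘ (f (n + j)).1 ∘ ((D n).φ t).symm -
        (D n).ψ t ∘ (f (n + (j + 1))).1 ∘ ((D n).φ t).symm) ((D n).ε t / 2 ^ j) := by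
    intro n t j
    obtain ⟨t', h1, h2, h3, h4⟩ := hctl n t j
    have := (hball (n + j) t').2.le.trans (ENNReal.ofReal_le_ofReal h4)
    rw [h1, h2, h3] at this
    exact boundedBy_of_norm_le (div_nonneg ((hgood n).1 t).2.2.le (by positivity)) this
  have hlim : ∀ n (t : (D n).T), ∀ x ∈ (D n).K t, ∃ y ∈ ((D n).ψ t).source,
      Tendsto (fun j => (f j).1 x) atTop (𝓝 y) := by
    intro n t x hx
    have hdist : ∀ j, dist ((D n).ψ t ((f (n + j)).1 x)) ((D n).ψ t ((f (n + (j + 1))).1 x)) ≤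
        (2 * (D n).ε t) / 2 / 2 ^ j := by
      intro j
      have := (hb n t j).norm_apply_le (mem_image_of_mem _ hx)
      rw [dist_eq_norm, mul_div_cancel_left₀ _ two_ne_zero]
      simpa [((D n).φ t).left_inv (((hgood n).1 t).1.subset_source hx)] using this
    obtain ⟨z, hz⟩ := cauchySeq_tendsto_of_complete (cauchySeq_of_le_geometric_two hdist)
    have hz0 : z ∈ ((D n).ψ t).target := by
      refine (hgood n).2 t x hx z ?_
      rw [dist_comm]
      exact dist_le_of_le_geometric_two_of_tendsto₀ hdist hz
    refine ⟨((D n).ψ t).symm z, ((D n).ψ t).map_target hz0, ?_⟩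
    rw [← tendsto_add_atTop_iff_nat n]
    refine ((((D n).ψ t).continuousAt_symm hz0).tendsto.comp hz).congr fun j => ?_
    simp [((D n).ψ t).left_inv (hmaps n t j hx), add_comm]
  have hlim' : ∀ x, ∃ y, Tendsto (fun j => (f j).1 x) atTop (𝓝 y) := by
    intro x
    obtain ⟨n, t, hx⟩ := hcov x
    obtain ⟨y, -, hy⟩ := hlim n t x (interior_subset hx)
    exact ⟨y, hy⟩
  choose g hg using hlim'
  have hgs : ∀ n (t : (D n).T), MapsTo g ((D n).K t) ((D n).ψ t).source := by
    intro n t x hx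
    obtain ⟨y, hy, hy'⟩ := hlim n t x hx
    rwa [tendsto_nhds_unique (hg x) hy']
  have hloc : ∀ n (t : (D n).T),
      ContDiffOn ℝ k ((D n).ψ t ∘ g ∘ ((D n).φ t).symm) (interior ((D n).φ t '' (D n).K t)) ∧
      BoundedBy k α (interior ((D n).φ t '' (D n).K t))
        ((D n).ψ t ∘ (f n).1 ∘ ((D n).φ t).symm - (D n).ψ t ∘ g ∘ ((D n).φ t).symm)
        (2 * (D n).ε t) := by
    intro n t
    refine contDiffOn_and_boundedBy_of_geometric
      (h := fun j => (D n).ψ t ∘ (f (n + j)).1 ∘ ((D n).φ t).symm)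
      (fun j => contDiffAt_of_mem_maps (f (n + j)).2 ((hgood n).1 t).1 (hmaps n t j))
      (hb n t) ?_
    rintro _ ⟨x, hx, rfl⟩
    have h1 := (hg x).comp (tendsto_add_atTop_nat n)
    have h2 := (((D n).ψ t).continuousAt (hgs n t hx)).tendsto.comp h1
    simpa [((D n).φ t).left_inv (((hgood n).1 t).1.subset_source hx), Function.comp_def,
      add_comm n] using h2
  have hgm : g ∈ maps M N k (ckHolderSeminorm (m := m) (d := d) k α) := by
    have hcd : ∀ n (t : (D n).T), ∀ x ∈ interior ((D n).K t),
        interior ((D n).φ t '' (D n).K t) ∈ 𝓝 ((D n).φ t x) := fun n t x hx =>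
      isOpen_interior.mem_nhds
        (image_interior_subset _ ((hgood n).1 t).1.subset_source (mem_image_of_mem _ hx))
    refine mem_maps_of_holderAt (m := m) (d := d) hα₀ hα₁ (fun x => ?_) (fun x => ?_)
    · obtain ⟨n, t, hx⟩ := hcov x
      have hc := ((hgood n).1 t).1
      refine contMDiffAt_of_contDiffAt_chart_comp hc.source_mem hc.target_mem
        ((hloc n t).1.contDiffAt (hcd n t x hx)) (hc.subset_source (interior_subset hx)) ?_
      filter_upwards [isOpen_interior.mem_nhds hx] with y hy using hgs n t (interior_subset hy)
    · obtain ⟨n, t, hx⟩ := hcov x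
      have hc := ((hgood n).1 t).1
      have hxK := interior_subset hx
      refine ⟨_, _, hc.source_mem, hc.target_mem, hc.subset_source hxK, hgs n t hxK, ?_⟩
      have hfc := contDiffAt_of_mem_maps (f n).2 hc (hmaps n t 0) _ (mem_image_of_mem _ hxK)
      obtain ⟨c, -, hfb⟩ := norm_lt_top_iff.1 ((f n).2.2 _ _ _ hc (hmaps n t 0))
      -- the representative of `g` is that of `f n` minus a map with finite norm
      have h1 := hfb.holderAt hfc (mem_of_superset (hcd n t x hx) interior_subset)
      have h2 := (hloc n t).2.holderAt
        (hfc.sub ((hloc n t).1.contDiffAt (hcd n t x hx))) (hcd n t x hx)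
      have h3 := h1.add (h2.comp_left hα₀ hα₁ contDiff_neg.contDiffAt)
      refine h3.congr_of_eventuallyEq (Eventually.of_forall fun y => ?_)
      simp
  refine ⟨⟨g, hgm⟩, fun n t => ⟨hgs n t, (hloc n t).2.mono ?_⟩⟩
  exact image_interior_subset _ ((hgood n).1 t).1.subset_source

end ChartFamily

end ChartFamilies

/-! ### The Baire category argument -/

section Baire

variable {m d : ℕ}
  {M : Type*} [TopologicalSpace M] [ChartedSpace (EuclideanSpace ℝ (Fin m)) M]
  {N : Type*} [TopologicalSpace N] [ChartedSpace (EuclideanSpace ℝ (Fin d)) N]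
  {k : ℕ} {α : ℝ}

/-- A class `Adm` of families of chart data *describes* a topology on `C^{k+α}(M, N)` if the balls
of the valid families in the class form neighbourhood bases.  The class is required to contain the
finite families, to be closed under disjoint unions, and to impose conditions on the charts of `M`
and `N` only. -/
structure Describes (Adm : ChartFamily m d M N → Prop)
    (τ : TopologicalSpace (maps M N k (ckHolderSeminorm (m := m) (d := d) k α))) : Prop where
  of_finite : ∀ D, Finite D.T → Adm D
  sum : ∀ D D', Adm D → Adm D' → Adm (D.sum D')
  withData : ∀ D K ε, Adm D → Adm (D.withData K ε)
  ball_mem_nhds : ∀ (f : maps M N k (ckHolderSeminorm (m := m) (d := d) k α)) D, Adm D →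
    D.Valid f.1 → D.ball f ∈ 𝓝 f
  exists_ball_subset : ∀ (f : maps M N k (ckHolderSeminorm (m := m) (d := d) k α)) O, IsOpen O →
    f ∈ O → ∃ D, Adm D ∧ D.Valid f.1 ∧ D.ball f ⊆ O

variable [IsManifold (𝓡 m) ∞ M] [IsManifold (𝓡 d) ∞ N] {Adm : ChartFamily m d M N → Prop}
  {τ : TopologicalSpace (maps M N k (ckHolderSeminorm (m := m) (d := d) k α))}

/-- One step of the construction behind `Describes.baireSpace`: a family centred at `f ∈ O` that
refines `D`, covers `A` and is so fine that every map near `f` with respect to it lies in `O`. -/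
theorem Describes.exists_refinement [LocallyCompactSpace M] (h : Describes Adm τ)
    {f : maps M N k (ckHolderSeminorm k α)} {D : ChartFamily m d M N}
    (hD : (D.withData D.K fun t => D.ε t / 2).Good f.1) (hA : Adm D)
    {O : Set (maps M N k (ckHolderSeminorm (m := m) (d := d) k α))} (hO : IsOpen O) (hf : f ∈ O)
    {A : Set M} (hAc : IsCompact A) :
    ∃ D' : ChartFamily m d M N, D'.Good f.1 ∧ Adm D' ∧ D'.Refines D ∧ D'.Covers A ∧
      ∀ g : maps M N k (ckHolderSeminorm k α), D'.Near k α f.1 g.1 → g ∈ O := by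
  obtain ⟨D₁, hA₁, hv₁, hsub⟩ := h.exists_ball_subset f O hO hf
  obtain ⟨K', δ, hg₁, hnear⟩ := hv₁.exists_good
  obtain ⟨D₂, hfin, hg₂, hcov⟩ := ChartFamily.exists_good_covers (m := m) (d := d)
    f.2.1.continuous hAc
  refine ⟨((D.withData D.K fun t => D.ε t / 2).sum (D₁.withData K' δ)).sum D₂,
    (hD.sum hg₁).sum hg₂,
    h.sum _ _ (h.sum _ _ (h.withData _ _ _ hA) (h.withData _ _ _ hA₁)) (h.of_finite _ hfin),
    fun t => ⟨Sum.inl (Sum.inl t), rfl, rfl, rfl, le_rfl⟩, fun x hx => ?_,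
    fun g hg => hsub (hnear g hg.of_sum_left.of_sum_right)⟩
  obtain ⟨t, ht⟩ := hcov x hx
  exact ⟨Sum.inr t, ht⟩

/-- The Baire category argument, common to the weak and the strong topology: `M` is exhausted by
compact sets, and a sequence of maps is constructed together with good families that refine each
other, so that the limit of the sequence lies in all the prescribed open sets. -/
theorem Describes.baireSpace [SecondCountableTopology M] [T2Space N] (hα₀ : 0 ≤ α) (hα₁ : α ≤ 1)
    (h : Describes Adm τ) :
    @BaireSpace (maps M N k (ckHolderSeminorm (m := m) (d := d) k α)) τ := by
  have : LocallyCompactSpace M := ChartedSpace.locallyCompactSpace (EuclideanSpace ℝ (Fin m)) M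
  refine ⟨fun O hO hdense => dense_iff_inter_open.2 fun U hU hne => ?_⟩
  -- a map together with a good family centred at it
  let State := {p : maps M N k (ckHolderSeminorm (m := m) (d := d) k α) × ChartFamily m d M N //
    p.2.Good p.1.1 ∧ Adm p.2}
  have hstep : ∀ (n : ℕ) (p : State), ∃ q : State,
      q.1.1 ∈ p.1.2.ball p.1.1 ∧ q.1.2.Refines p.1.2 ∧ q.1.2.Covers (compactCovering M n) ∧
        ∀ g : maps M N k (ckHolderSeminorm k α), q.1.2.Near k α q.1.1.1 g.1 → g ∈ O n := by
    rintro n ⟨⟨f, D⟩, hg, hA⟩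
    obtain ⟨f', hf', hf'O⟩ := (hdense n).inter_nhds_nonempty (h.ball_mem_nhds f D hA hg.1)
    obtain ⟨D', h1, h2, h3, h4, h5⟩ :=
      h.exists_refinement (hg.half hf'O) hA (hO n) hf' (isCompact_compactCovering M n)
    exact ⟨⟨⟨f', D'⟩, h1, h2⟩, hf'O, h3, h4, h5⟩
  obtain ⟨f₀, hf₀⟩ := hne
  obtain ⟨D₀, hA₀, hv₀, hsub₀⟩ := h.exists_ball_subset f₀ U hU hf₀
  obtain ⟨K', δ, hg₀, hnear₀⟩ := hv₀.exists_good
  choose step hs1 hs2 hs3 hs4 using hstep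
  let s : ℕ → State := fun n =>
    Nat.rec ⟨⟨f₀, D₀.withData K' δ⟩, hg₀, h.withData _ _ _ hA₀⟩ step n
  have hs : ∀ n, s (n + 1) = step n (s n) := fun n => rfl
  obtain ⟨g, hg⟩ := ChartFamily.exists_limit hα₀ hα₁ (f := fun n => (s n).1.1)
    (D := fun n => (s n).1.2) (fun n => (s n).2.1) (fun n => hs2 n (s n)) (fun n => hs1 n (s n))
    (fun x => by
      obtain ⟨n, hn⟩ := mem_iUnion.1 ((iUnion_compactCovering M).symm ▸ mem_univ x)
      exact ⟨n + 1, hs3 n (s n) x hn⟩)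
  exact ⟨g, hsub₀ (hnear₀ g (hg 0)), mem_iInter.2 fun n => hs4 n (s n) g (hg (n + 1))⟩

end Baire

/-! ### Neighbourhood bases of the Whitney topologies -/

section Topologies

variable {m d : ℕ}
  {M : Type*} [TopologicalSpace M] [ChartedSpace (EuclideanSpace ℝ (Fin m)) M]
  {N : Type*} [TopologicalSpace N] [ChartedSpace (EuclideanSpace ℝ (Fin d)) N]
  {k : ℕ} {α : ℝ}

/-- For a generated topology it suffices to find balls in the generating sets. -/
theorem exists_ball_subset_of_generateFrom {Adm : ChartFamily m d M N → Prop}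
    (hfin : ∀ D, Finite D.T → Adm D) (hsum : ∀ D D', Adm D → Adm D' → Adm (D.sum D'))
    {𝒢 : Set (Set (maps M N k (ckHolderSeminorm (m := m) (d := d) k α)))}
    (h𝒢 : ∀ W ∈ 𝒢, ∀ f ∈ W, ∃ D, Adm D ∧ D.Valid f.1 ∧ D.ball f ⊆ W)
    (f : maps M N k (ckHolderSeminorm (m := m) (d := d) k α))
    {O : Set (maps M N k (ckHolderSeminorm (m := m) (d := d) k α))}
    (hO : TopologicalSpace.GenerateOpen 𝒢 O) (hf : f ∈ O) :
    ∃ D, Adm D ∧ D.Valid f.1 ∧ D.ball f ⊆ O := by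
  induction hO with
  | basic W hW => exact h𝒢 W hW f hf
  | univ =>
    exact ⟨⟨Empty, Empty.elim, Empty.elim, Empty.elim, Empty.elim⟩,
      hfin _ (inferInstanceAs (Finite Empty)), fun t => t.elim, subset_univ _⟩
  | inter s t _ _ ihs iht =>
    obtain ⟨D, h1, h2, h3⟩ := ihs hf.1
    obtain ⟨D', h1', h2', h3'⟩ := iht hf.2
    refine ⟨D.sum D', hsum _ _ h1 h1', h2.sum h2', ?_⟩
    rw [ChartFamily.ball_sum]
    exact inter_subset_inter h3 h3'
  | sUnion 𝒮 _ ih =>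
    obtain ⟨s, hs, hfs⟩ := hf
    obtain ⟨D, h1, h2, h3⟩ := ih s hs hfs
    exact ⟨D, h1, h2, h3.trans (subset_sUnion_of_mem hs)⟩

variable [IsManifold (𝓡 m) ∞ M] [IsManifold (𝓡 d) ∞ N]

/-- A member of a sub-basic neighbourhood is the centre of a smaller one, by the triangle
inequality. -/
theorem exists_nhd_subset {f g : maps M N k (ckHolderSeminorm k α)}
    {φ : OpenPartialHomeomorph M (EuclideanSpace ℝ (Fin m))}
    {ψ : OpenPartialHomeomorph N (EuclideanSpace ℝ (Fin d))} {K : Set M} {ε : ℝ≥0∞}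
    (hK : ChartData φ ψ K) (hf : MapsTo f.1 K ψ.source) (hg : g ∈ nhd f φ ψ K ε) :
    ∃ δ : ℝ, 0 < δ ∧ nhd g φ ψ K (ENNReal.ofReal δ) ⊆ nhd f φ ψ K ε := by
  obtain ⟨hgK, hgε⟩ := hg
  obtain ⟨δ, hδ, hδε⟩ := ENNReal.lt_iff_exists_nnreal_btwn.1 (tsub_pos_of_lt hgε)
  refine ⟨δ, by exact_mod_cast hδ, fun e he => ⟨he.1, ?_⟩⟩
  have hcf := contDiffAt_of_mem_maps f.2 hK hf
  have hcg := contDiffAt_of_mem_maps g.2 hK hgK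
  have hce := contDiffAt_of_mem_maps e.2 hK he.1
  refine lt_of_le_of_lt ?_ (lt_tsub_iff_left.1 (lt_trans (by simpa using he.2) hδε))
  rw [← sub_add_sub_cancel _ (ψ ∘ g.1 ∘ φ.symm) _]
  exact norm_add_le (fun y hy => (hcf y hy).sub (hcg y hy))
    (fun y hy => (hcg y hy).sub (hce y hy))

theorem describes_weakTopology :
    Describes (fun D : ChartFamily m d M N => Finite D.T)
      (weakTopology M N k (ckHolderSeminorm (m := m) (d := d) k α)) where
  of_finite _ h := h
  sum D D' _ _ := inferInstanceAs (Finite (D.T ⊕ D'.T))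
  withData _ _ _ h := h
  ball_mem_nhds f D hD hv := by
    let _ := weakTopology M N k (ckHolderSeminorm (m := m) (d := d) k α)
    have hfin : Finite D.T := hD
    have : D.ball f = ⋂ t, nhd f (D.φ t) (D.ψ t) (D.K t) (ENNReal.ofReal (D.ε t)) := by
      ext g
      simp [ChartFamily.ball]
    refine IsOpen.mem_nhds ?_ (ChartFamily.self_mem_ball f hv)
    rw [this]
    exact isOpen_iInter_of_finite fun t => TopologicalSpace.isOpen_generateFrom_of_mem
      ⟨f, _, _, _, _, (hv t).1, (hv t).2.1, ENNReal.ofReal_pos.2 (hv t).2.2, rfl⟩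
  exists_ball_subset f O hO hf := by
    refine exists_ball_subset_of_generateFrom (Adm := fun D => Finite D.T) (fun _ h => h)
      (fun D D' _ _ => inferInstanceAs (Finite (D.T ⊕ D'.T))) ?_ f hO hf
    rintro _ ⟨f₀, φ, ψ, K, ε, hK, hmaps, -, rfl⟩ f hf
    obtain ⟨δ, hδ, hsub⟩ := exists_nhd_subset hK hmaps hf
    exact ⟨⟨Unit, fun _ => φ, fun _ => ψ, fun _ => K, fun _ => δ⟩, inferInstanceAs (Finite Unit),
      fun _ => ⟨hK, hf.1, hδ⟩, fun g hg => hsub (hg ())⟩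

theorem describes_strongTopology :
    Describes (fun D : ChartFamily m d M N => LocallyFinite fun t => (D.φ t).source)
      (strongTopology M N k (ckHolderSeminorm (m := m) (d := d) k α)) where
  of_finite D h := locallyFinite_of_finite _
  sum D D' h h' := locallyFinite_sum.2 ⟨h, h'⟩
  withData _ _ _ h := h
  ball_mem_nhds f D hD hv := by
    let _ := strongTopology M N k (ckHolderSeminorm (m := m) (d := d) k α)
    refine IsOpen.mem_nhds ?_ (ChartFamily.self_mem_ball f hv)
    exact TopologicalSpace.isOpen_generateFrom_of_mem ⟨f, D.T, D.φ, D.ψ, D.K, _, hD,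
      fun t => ⟨(hv t).1, (hv t).2.1, ENNReal.ofReal_pos.2 (hv t).2.2⟩, rfl⟩
  exists_ball_subset f O hO hf := by
    refine exists_ball_subset_of_generateFrom
      (Adm := fun D => LocallyFinite fun t => (D.φ t).source)
      (fun D _ => locallyFinite_of_finite _) (fun D D' h h' => locallyFinite_sum.2 ⟨h, h'⟩) ?_
      f hO hf
    rintro _ ⟨f₀, T, φ, ψ, K, ε, hfin, hv, rfl⟩ f hf
    choose δ hδ hsub using fun t => exists_nhd_subset (hv t).1 (hv t).2.1 (hf t)
    exact ⟨⟨T, φ, ψ, K, δ⟩, hfin, fun t => ⟨(hv t).1, (hf t).1, hδ t⟩,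
      fun g hg t => hsub t (hg t)⟩

end Topologies

end Whitney

theorem mainTheorem2 (m d : ℕ)
    (M : Type*) [TopologicalSpace M] [T2Space M] [SecondCountableTopology M]
    [ChartedSpace (EuclideanSpace ℝ (Fin m)) M] [IsManifold (𝓡 m) ∞ M]
    (N : Type*) [TopologicalSpace N] [T2Space N] [SecondCountableTopology N]
    [ChartedSpace (EuclideanSpace ℝ (Fin d)) N] [IsManifold (𝓡 d) ∞ N]
    (k : ℕ) :
    (∀ α : ℝ, 0 ≤ α → α < 1 →
      @BaireSpace (Whitney.maps M N k (Whitney.ckHolderSeminorm (m := m) (d := d) k α))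
        (Whitney.weakTopology M N k (Whitney.ckHolderSeminorm (m := m) (d := d) k α)) ∧
      @BaireSpace (Whitney.maps M N k (Whitney.ckHolderSeminorm (m := m) (d := d) k α))
        (Whitney.strongTopology M N k (Whitney.ckHolderSeminorm (m := m) (d := d) k α))) ∧
    (@BaireSpace (Whitney.maps M N k (Whitney.ckLipSeminorm (m := m) (d := d) k))
        (Whitney.weakTopology M N k (Whitney.ckLipSeminorm (m := m) (d := d) k)) ∧
      @BaireSpace (Whitney.maps M N k (Whitney.ckLipSeminorm (m := m) (d := d) k))
        (Whitney.strongTopology M N k (Whitney.ckLipSeminorm (m := m) (d := d) k))) := by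

  rw [Whitney.ckLipSeminorm_eq]
  exact ⟨fun α hα₀ hα₁ =>
      ⟨Whitney.describes_weakTopology.baireSpace hα₀ hα₁.le,
        Whitney.describes_strongTopology.baireSpace hα₀ hα₁.le⟩,
    Whitney.describes_weakTopology.baireSpace zero_le_one le_rfl,
    Whitney.describes_strongTopology.baireSpace zero_le_one le_rfl⟩
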